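/- For real constants $a,b,c,d,e$ let $T(n)$, $n\ge 0$, be the sequence defined by the single initial value $T(0)=1$ and the recurrence $$(n+1)^3T(n+1)=(2n+1)(an^2+an+b)\,T(n)+n(cn^2+d)\,T(n-1)+e\,n(2n-1)(n-1)\,T(n-2)\qquad(n\ge 0),$$ in which the coefficient of $T(n-1)$ vanishes for $n=0$ and the coefficient of $T(n-2)$ vanishes for $n=0,1$, so that no further initial values are needed. Write $T_{14A},T_{14B},T_{14C},T_{14\overline C}$ for the sequences obtained for the following values of $(a,b,c,d,e)$: $$\begin{array}{ll} T_{14A}: & (3,\;1,\;47,\;4,\;14),\\ T_{14B}: & (11,\;5,\;-121,\;-20,\;98),\\ T_{14C}: & (8\sqrt2-7,\;4\sqrt2-4,\;168\sqrt2-205,\;32\sqrt2-43,\;28(11\sqrt2-16)),\\ T_{14\overline C}: & (-8\sqrt2-7,\;-4\sqrt2-4,\;-168\sqrt2-205,\;-32\sqrt2-43,\;-28(11\sqrt2+16)). \end{array}$$ Theorem. For all complex $w$ in some neighborhood of $w=0$ the following four series converge absolutely and have the same sum: $$\begin{aligned} \sum_{n=0}^\infty T_{14A}(n)\left(\frac{w}{1+5w+8w^2}\right)^{n+1}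 &=\sum_{n=0}^\infty T_{14B}(n)\left(\frac{w}{1+9w+8w^2}\right)^{n+1}\\ &=\sum_{n=0}^\infty T_{14C}(n)\left(\frac{w}{1+\sqrt{32}\,w+8w^2}\right)^{n+1}\\ &=\sum_{n=0}^\infty T_{14\overline C}(n)\left(\frac{w}{1-\sqrt{32}\,w+8w^2}\right)^{n+1}. \end{aligned}$$ -/

import Mathlib

/-- The sequence with `T 0 = 1` and, for all `n ≥ 0`,
`(n+1)^3 T(n+1) = (2n+1)(a n^2 + a n + b) T(n) + n (c n^2 + d) T(n-1)
  + e n (2n-1)(n-1) T(n-2)`.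
The coefficient of `T(n-1)` vanishes for `n = 0` and that of `T(n-2)` for `n = 0` and `n = 1`, so
the single value `T 0 = 1` starts the recurrence; the clauses for `1` and `2` are its instances
`n = 0` and `n = 1`. -/
noncomputable def fourTermSeq (a b c d e : ℝ) : ℕ → ℝ
  | 0 => 1
  | 1 => b
  | 2 => (3 * (2 * a + b) * fourTermSeq a b c d e 1 + (c + d) * fourTermSeq a b c d e 0) / 8
  | k + 3 =>
    let n : ℝ := (k : ℝ) + 2
    ((2 * n + 1) * (a * n ^ 2 + a * n + b) * fourTermSeq a b c d e (k + 2)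
      + n * (c * n ^ 2 + d) * fourTermSeq a b c d e (k + 1)
      + e * n * (2 * n - 1) * (n - 1) * fourTermSeq a b c d e k) / (n + 1) ^ 3

theorem fourTermSeq_zero (a b c d e : ℝ) : fourTermSeq a b c d e 0 = 1 := by
  rw [fourTermSeq]

/-- The recurrence holds for every `n`; the values of `T` at the truncated indices are
multiplied by `0`. -/
theorem fourTermSeq_rec (a b c d e : ℝ) (n : ℕ) :
    ((n : ℝ) + 1) ^ 3 * fourTermSeq a b c d e (n + 1) =
      (2 * (n : ℝ) + 1) * (a * (n : ℝ) ^ 2 + a * n + b) * fourTermSeq a b c d e n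
      + n * (c * (n : ℝ) ^ 2 + d) * fourTermSeq a b c d e (n - 1)
      + e * n * (2 * (n : ℝ) - 1) * ((n : ℝ) - 1) * fourTermSeq a b c d e (n - 2) := by
  match n with
  | 0 => simp [fourTermSeq]
  | 1 => simp [fourTermSeq]; ring
  | k + 2 =>
    have h : ((k : ℝ) + 2 + 1) ^ 3 ≠ 0 := by positivity
    rw [show k + 2 + 1 = k + 3 from rfl, fourTermSeq]
    simp only [Nat.add_sub_cancel, show k + 2 - 1 = k + 1 from rfl]
    push_cast
    rw [mul_div_cancel₀ _ h]

/-- The sequence attached to `ε = 5`. -/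
noncomputable def T14A : ℕ → ℝ := fourTermSeq 3 1 47 4 14

/-- The sequence attached to `ε = 9`. -/
noncomputable def T14B : ℕ → ℝ := fourTermSeq 11 5 (-121) (-20) 98

/-- The sequence attached to `ε = √32`. -/
noncomputable def T14C : ℕ → ℝ :=
  fourTermSeq (8 * √2 - 7) (4 * √2 - 4) (168 * √2 - 205) (32 * √2 - 43) (28 * (11 * √2 - 16))

/-- The sequence attached to `ε = -√32`, the conjugate of `T14C`. -/
noncomputable def T14Cbar : ℕ → ℝ :=
  fourTermSeq (-8 * √2 - 7) (-4 * √2 - 4) (-168 * √2 - 205) (-32 * √2 - 43)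
    (-28 * (11 * √2 + 16))

/-!
Each four-term sequence is the sequence of moments `T n = L (X ^ n)` of a linear functional `L` on
polynomials that annihilates the range of a third-order operator built from a quartic and a
quadratic polynomial. For the four sequences of level `14` these pairs of polynomials are
translates, by the numbers `ε`, of the single pair `(X + 5) (X + 9) (X ^ 2 - 32)` and
`X ^ 2 + 8 X + 11`; the shift by `ε` moves a root of the quartic to the origin, which is what makes
the recurrence four-term. The operator commutes with translations, so the sequences are binomial
transforms of one another. On generating functions `∑ T n x ^ (n + 1)` the binomial transform is
the substitution `1 / x ↦ 1 / x - δ`, and `1 / x = 1 / w + ε + 8 w` absorbs it.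
-/

open Finset Filter Topology Polynomial

section BinomialTransform

/-- The binomial transform of a sequence with parameter `δ`: if `S` is the sequence of moments
of a functional about `0`, this is the sequence of its moments about `-δ`. -/
def binomialTransform {A : Type*} [CommSemiring A] (δ : A) (S : ℕ → A) (n : ℕ) : A :=
  ∑ kj ∈ antidiagonal n, (n.choose kj.1 : A) * δ ^ kj.2 * S kj.1

theorem map_binomialTransform {A B : Type*} [CommSemiring A] [CommSemiring B] (f : A →+* B) (δ : A)
    (S : ℕ → A) (n : ℕ) :
    f (binomialTransform δ S n) = binomialTransform (f δ) (fun k => f (S k)) n := by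
  simp only [binomialTransform, map_sum, map_mul, map_natCast, map_pow]

variable {𝕜 : Type*} [NormedField 𝕜] {S : ℕ → 𝕜} {ρ : ℝ} {δ x : 𝕜}

theorem hasSum_mul_choose_mul_geometric (S : ℕ → 𝕜) (hδx : ‖δ * x‖ < 1) (k : ℕ) :
    HasSum (fun j : ℕ => S k * x ^ (k + 1) * ((j + k).choose k * (δ * x) ^ j))
      (S k * (x / (1 - δ * x)) ^ (k + 1)) := by
  convert! (hasSum_choose_mul_geometric_of_norm_lt_one k hδx).mul_left (S k * x ^ (k + 1)) using 1
  rw [div_pow, mul_assoc, mul_one_div]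

variable [CompleteSpace 𝕜]

theorem summable_mul_choose_mul_geometric (hS : ∀ k, ‖S k‖ ≤ ρ ^ k) (hx : ‖x‖ * (ρ + ‖δ‖) < 1) :
    Summable fun kj : ℕ × ℕ =>
      S kj.1 * x ^ (kj.1 + 1) * ((kj.2 + kj.1).choose kj.1 * (δ * x) ^ kj.2) := by
  have hρ : 0 ≤ ρ := by simpa using (norm_nonneg _).trans (hS 1)
  have hδx : ‖δ‖ * ‖x‖ < 1 := by nlinarith [mul_nonneg (norm_nonneg x) hρ]
  have hδx' : ‖‖δ‖ * ‖x‖‖ < 1 := by rwa [Real.norm_of_nonneg (by positivity)]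
  have fiber := hasSum_mul_choose_mul_geometric (x := ‖x‖) (fun k => ρ ^ k) hδx'
  have ratio_lt_one : ρ * (‖x‖ / (1 - ‖δ‖ * ‖x‖)) < 1 := by
    rw [← mul_div_assoc, div_lt_one (by linarith)]
    linarith
  have geometric := (summable_geometric_of_lt_one
    (mul_nonneg hρ (div_nonneg (norm_nonneg x) (by linarith))) ratio_lt_one).mul_right
    (‖x‖ / (1 - ‖δ‖ * ‖x‖))
  let majorant : ℕ × ℕ → ℝ := fun kj =>
    ρ ^ kj.1 * ‖x‖ ^ (kj.1 + 1) * ((kj.2 + kj.1).choose kj.1 * (‖δ‖ * ‖x‖) ^ kj.2)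
  have majorant_nonneg : 0 ≤ majorant := fun _ => by simp only [majorant, Pi.zero_apply]; positivity
  have summable_majorant : Summable majorant := by
    refine (summable_prod_of_nonneg majorant_nonneg).2
      ⟨fun k => (fiber k).summable, geometric.congr fun k => ?_⟩
    rw [(fiber k).tsum_eq]
    ring
  refine summable_majorant.of_norm_bounded fun kj => ?_
  simp only [majorant, norm_mul, norm_pow]
  gcongr
  · exact hS _
  · simpa using Nat.norm_cast_le (α := 𝕜) _

/-- Sum the double series `S k * x ^ (k + 1) * (j + k).choose k * (δ * x) ^ j` along the
antidiagonals `j + k = n`, and along the rows of constant `k`. -/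
theorem hasSum_binomialTransform_mul_pow (hS : ∀ k, ‖S k‖ ≤ ρ ^ k) (hx : ‖x‖ * (ρ + ‖δ‖) < 1) :
    HasSum (fun n => binomialTransform δ S n * x ^ (n + 1))
      (∑' k, S k * (x / (1 - δ * x)) ^ (k + 1)) := by
  have hρ : 0 ≤ ρ := by simpa using (norm_nonneg _).trans (hS 1)
  have hδx : ‖δ * x‖ < 1 := by
    rw [norm_mul]
    nlinarith [mul_nonneg (norm_nonneg x) hρ]
  have double := (summable_mul_choose_mul_geometric hS hx).hasSum
  rw [(double.prod_fiberwise (hasSum_mul_choose_mul_geometric S hδx)).tsum_eq]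
  refine ((HasAntidiagonal.sigmaAntidiagonalEquivProd.hasSum_iff.2 double).sigma
    fun n => hasSum_fintype _).congr_fun fun n => ?_
  rw [binomialTransform, sum_mul, ← sum_coe_sort]
  refine sum_congr rfl fun ⟨kj, hkj⟩ _ => ?_
  obtain rfl : kj.2 + kj.1 = n := by rw [add_comm]; exact mem_antidiagonal.1 hkj
  simp only [Function.comp_apply, HasAntidiagonal.sigmaAntidiagonalEquivProd_apply]
  ring

end BinomialTransform

section MomentFunctional

variable {A : Type*} [CommSemiring A]

/-- The linear functional on polynomials whose `n`-th moment is `T n`. -/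
noncomputable def momentFunctional (T : ℕ → A) : A[X] →ₗ[A] A :=
  (basisMonomials A).constr A T

theorem momentFunctional_X_pow (T : ℕ → A) (n : ℕ) : momentFunctional T (X ^ n) = T n := by
  simpa [momentFunctional, X_pow_eq_monomial] using (basisMonomials A).constr_basis A T n

theorem momentFunctional_X_add_C_pow (T : ℕ → A) (δ : A) (n : ℕ) :
    momentFunctional T ((X + C δ) ^ n) = binomialTransform δ T n := by
  rw [(Commute.all X (C δ)).add_pow', map_sum]
  refine sum_congr rfl fun kj _ => ?_
  rw [← C_pow, mul_comm, ← smul_eq_C_mul, map_nsmul, map_smul, momentFunctional_X_pow,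
    nsmul_eq_mul, smul_eq_mul, mul_assoc]

end MomentFunctional

section SymSqOperator

variable {A : Type*} [CommRing A]

/-- The symmetric square of the second-order operator `Q ∂² + 1/2 Q' ∂ + 1/4 R`: it annihilates the
products of two solutions of the latter. The leading coefficient is normalized to `2 * Q` rather
than `Q` to avoid denominators. -/
noncomputable def symSqOperator (Q R : A[X]) : A[X] →ₗ[A] A[X] :=
  (2 * Q) • derivative ^ 3 + (3 * derivative Q) • derivative ^ 2
    + (derivative (derivative Q) + 2 * R) • derivative + derivative R • LinearMap.id

theorem symSqOperator_apply (Q R p : A[X]) :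
    symSqOperator Q R p = 2 * Q * derivative (derivative (derivative p))
      + 3 * derivative Q * derivative (derivative p)
      + (derivative (derivative Q) + 2 * R) * derivative p + derivative R * p :=
  rfl

theorem derivative_taylor (r : A) (p : A[X]) :
    derivative (taylor r p) = taylor r (derivative p) := by
  simp [taylor_apply, derivative_comp]

theorem symSqOperator_taylor (r : A) (Q R p : A[X]) :
    symSqOperator (taylor r Q) (taylor r R) (taylor r p) = taylor r (symSqOperator Q R p) := by
  simp only [symSqOperator_apply, derivative_taylor, map_add, taylor_mul]
  simp [taylor_apply]

/-- The polynomial `Q` for which `symSqOperator Q R` encodes the four-term recurrence. It has no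
constant term, since the operator would otherwise involve `X ^ (n - 3)`. -/
noncomputable def fourTermQuartic (a c e : A) : A[X] :=
  X ^ 4 - C (2 * a) * X ^ 3 - C c * X ^ 2 - C (2 * e) * X

/-- The polynomial `R` for which `symSqOperator Q R` encodes the four-term recurrence. -/
noncomputable def fourTermQuadratic (b d : A) : A[X] :=
  X ^ 2 - C (2 * b) * X - C d

theorem symSqOperator_fourTerm_X_pow (a b c d e : A) (n : ℕ) :
    symSqOperator (fourTermQuartic a c e) (fourTermQuadratic b d) (X ^ n) =
      (2 : A) • (((n : A) + 1) ^ 3 • X ^ (n + 1)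
        - ((2 * (n : A) + 1) * (a * (n : A) ^ 2 + a * n + b)) • X ^ n
        - (n * (c * (n : A) ^ 2 + d)) • X ^ (n - 1)
        - (e * n * (2 * (n : A) - 1) * ((n : A) - 1)) • X ^ (n - 2)) := by
  rcases n with _ | _ | _ | n <;>
  · simp only [symSqOperator_apply, fourTermQuartic, fourTermQuadratic, derivative_mul,
      derivative_X_pow, derivative_X, derivative_C, derivative_one, smul_eq_C_mul, map_add,
      map_sub, map_mul, map_pow, map_natCast, map_ofNat, map_one, map_zero, derivative_natCast,
      derivative_ofNat, Nat.cast_add, Nat.cast_ofNat, Nat.cast_one, Nat.cast_zero, Nat.reduceAdd,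
      Nat.reduceSub, Nat.add_one_sub_one, Nat.reduceSubDiff, zero_tsub, pow_zero]
    ring

/-- The parameters `a, b, c, d, e` are read off from the expansions of the quartic `P` and the
quadratic `R` in powers of `X + ε`. In particular `-ε` is a root of `P`. -/
structure IsFourTermExpansion (P R : A[X]) (ε a b c d e : A) : Prop where
  quartic : taylor ε (fourTermQuartic a c e) = P
  quadratic : taylor ε (fourTermQuadratic b d) = R

end SymSqOperator

section FourTermSeq

variable {a b c d e a' b' c' d' e' : ℝ}

theorem eq_fourTermSeq_of_rec {T : ℕ → ℝ} (hT0 : T 0 = 1)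
    (hT : ∀ n : ℕ, ((n : ℝ) + 1) ^ 3 * T (n + 1) =
      (2 * (n : ℝ) + 1) * (a * (n : ℝ) ^ 2 + a * n + b) * T n
      + n * (c * (n : ℝ) ^ 2 + d) * T (n - 1)
      + e * n * (2 * (n : ℝ) - 1) * ((n : ℝ) - 1) * T (n - 2)) (n : ℕ) :
    T n = fourTermSeq a b c d e n := by
  induction n using Nat.strong_induction_on with
  | _ n ih =>
    match n with
    | 0 => rw [hT0, fourTermSeq_zero]
    | n + 1 =>
      have hn : ((n : ℝ) + 1) ^ 3 ≠ 0 := by positivity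
      refine mul_left_cancel₀ hn ?_
      rw [hT, fourTermSeq_rec, ih n (by lia), ih (n - 1) (by lia), ih (n - 2) (by lia)]

theorem abs_mul_add_le_of_abs_le {u m : ℝ} (hu : |u| ≤ m) (hm : 1 ≤ m) (p q : ℝ) :
    |p * u + q| ≤ (|p| + |q|) * m := by
  grw [abs_add_le, abs_mul, hu, add_mul, ← le_mul_of_one_le_right (abs_nonneg q) hm]

theorem abs_two_mul_add_one_mul_quadratic_le (a b : ℝ) {t : ℝ} (ht : 0 ≤ t) :
    |(2 * t + 1) * (a * t ^ 2 + a * t + b)| ≤ (t + 1) ^ 3 * (2 * (|a| + |b|)) :=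
  calc _ = (2 * t + 1) * |a * (t ^ 2 + t) + b| := by
        rw [abs_mul, abs_of_nonneg (by positivity), mul_add a]
    _ ≤ (2 * (t + 1)) * ((|a| + |b|) * (t + 1) ^ 2) := by
        gcongr
        · linarith
        · exact abs_mul_add_le_of_abs_le (by rw [abs_of_nonneg (by positivity)]; nlinarith)
            (one_le_pow₀ (by linarith)) a b
    _ = _ := by ring

theorem abs_mul_quadratic_le (c d : ℝ) {t : ℝ} (ht : 0 ≤ t) :
    |t * (c * t ^ 2 + d)| ≤ (t + 1) ^ 3 * (|c| + |d|) :=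
  calc _ = t * |c * t ^ 2 + d| := by rw [abs_mul, abs_of_nonneg ht]
    _ ≤ (t + 1) * ((|c| + |d|) * (t + 1) ^ 2) := by
        gcongr
        · linarith
        · exact abs_mul_add_le_of_abs_le (by rw [abs_of_nonneg (by positivity)]; nlinarith)
            (one_le_pow₀ (by linarith)) c d
    _ = _ := by ring

theorem abs_mul_two_mul_sub_one_mul_sub_one_le (e : ℝ) {t : ℝ} (ht : 0 ≤ t) :
    |e * t * (2 * t - 1) * (t - 1)| ≤ (t + 1) ^ 3 * (2 * |e|) :=
  calc _ = |e| * t * |2 * t - 1| * |t - 1| := by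
        rw [abs_mul, abs_mul, abs_mul, abs_of_nonneg ht]
    _ ≤ |e| * (t + 1) * (2 * (t + 1)) * (t + 1) := by
        gcongr
        · linarith
        · rw [abs_le]; constructor <;> linarith
        · rw [abs_le]; constructor <;> linarith
    _ = _ := by ring

theorem abs_fourTermSeq_succ_le (a b c d e : ℝ) (n : ℕ) :
    |fourTermSeq a b c d e (n + 1)| ≤
      2 * (|a| + |b|) * |fourTermSeq a b c d e n| + (|c| + |d|) * |fourTermSeq a b c d e (n - 1)|
        + 2 * |e| * |fourTermSeq a b c d e (n - 2)| := by
  have hn : (0 : ℝ) ≤ n := n.cast_nonneg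
  refine le_of_mul_le_mul_left ?_ (by positivity : 0 < ((n : ℝ) + 1) ^ 3)
  calc _ = |((n : ℝ) + 1) ^ 3 * fourTermSeq a b c d e (n + 1)| := by
        rw [abs_mul, abs_of_nonneg (by positivity : 0 ≤ ((n : ℝ) + 1) ^ 3)]
    _ ≤ |(2 * (n : ℝ) + 1) * (a * (n : ℝ) ^ 2 + a * n + b)| * |fourTermSeq a b c d e n|
        + |(n : ℝ) * (c * (n : ℝ) ^ 2 + d)| * |fourTermSeq a b c d e (n - 1)|
        + |e * n * (2 * (n : ℝ) - 1) * ((n : ℝ) - 1)| * |fourTermSeq a b c d e (n - 2)| := by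
        simp only [fourTermSeq_rec, ← abs_mul]
        exact abs_add_three _ _ _
    _ ≤ _ := by
        grw [abs_two_mul_add_one_mul_quadratic_le a b hn, abs_mul_quadratic_le c d hn,
          abs_mul_two_mul_sub_one_mul_sub_one_le e hn]
        exact le_of_eq (by ring)

theorem abs_fourTermSeq_le (a b c d e : ℝ) (n : ℕ) :
    |fourTermSeq a b c d e n| ≤ (1 + 2 * (|a| + |b|) + (|c| + |d|) + 2 * |e|) ^ n := by
  set ρ := 1 + 2 * (|a| + |b|) + (|c| + |d|) + 2 * |e| with hρ
  have one_le_ρ : 1 ≤ ρ := by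
    rw [hρ, add_assoc, add_assoc]
    exact le_add_of_nonneg_right (by positivity)
  induction n using Nat.strong_induction_on with
  | _ n ih =>
    match n with
    | 0 => simp [fourTermSeq_zero]
    | n + 1 =>
      have earlier (i : ℕ) : |fourTermSeq a b c d e (n - i)| ≤ ρ ^ n :=
        (ih (n - i) (by lia)).trans (pow_le_pow_right₀ one_le_ρ (by lia))
      calc |fourTermSeq a b c d e (n + 1)|
          ≤ 2 * (|a| + |b|) * ρ ^ n + (|c| + |d|) * ρ ^ n + 2 * |e| * ρ ^ n := by
            grw [abs_fourTermSeq_succ_le, ih n (by lia), earlier 1, earlier 2]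
        _ = (ρ - 1) * ρ ^ n := by rw [hρ]; ring
        _ ≤ ρ ^ (n + 1) := by
            rw [pow_succ']
            gcongr
            linarith

theorem comp_symSqOperator_fourTerm_eq_zero_iff (L : ℝ[X] →ₗ[ℝ] ℝ) :
    L ∘ₗ symSqOperator (fourTermQuartic a c e) (fourTermQuadratic b d) = 0 ↔
      ∀ n : ℕ, ((n : ℝ) + 1) ^ 3 * L (X ^ (n + 1)) =
        (2 * (n : ℝ) + 1) * (a * (n : ℝ) ^ 2 + a * n + b) * L (X ^ n)
        + n * (c * (n : ℝ) ^ 2 + d) * L (X ^ (n - 1))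
        + e * n * (2 * (n : ℝ) - 1) * ((n : ℝ) - 1) * L (X ^ (n - 2)) := by
  have on_X_pow (n : ℕ) := congrArg L (symSqOperator_fourTerm_X_pow a b c d e n)
  simp only [map_smul, map_sub, smul_eq_mul] at on_X_pow
  constructor
  · intro h n
    have := LinearMap.congr_fun h (X ^ n)
    rw [LinearMap.comp_apply, on_X_pow, LinearMap.zero_apply] at this
    linarith
  · refine fun h => (basisMonomials ℝ).ext fun n => ?_
    rw [coe_basisMonomials]
    beta_reduce
    rw [← X_pow_eq_monomial, LinearMap.comp_apply, on_X_pow, h, LinearMap.zero_apply]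
    ring

variable {P R : ℝ[X]} {ε ε' : ℝ}

theorem fourTermSeq_eq_binomialTransform (h : IsFourTermExpansion P R ε a b c d e)
    (h' : IsFourTermExpansion P R ε' a' b' c' d' e') (n : ℕ) :
    fourTermSeq a' b' c' d' e' n =
      binomialTransform (ε' - ε) (fourTermSeq a b c d e) n := by
  set L := momentFunctional (fourTermSeq a b c d e)
  have hL : L ∘ₗ symSqOperator (fourTermQuartic a c e) (fourTermQuadratic b d) = 0 :=
    (comp_symSqOperator_fourTerm_eq_zero_iff L).2 fun n => by
      simpa only [L, momentFunctional_X_pow] using fourTermSeq_rec a b c d e n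
  have translate {f g : ℝ[X]} (hfg : taylor ε' f = taylor ε g) : taylor (ε' - ε) f = g := by
    rw [sub_eq_neg_add, ← taylor_taylor, hfg, taylor_taylor, neg_add_cancel, taylor_zero]
  have hL' : (L ∘ₗ taylor (ε' - ε)) ∘ₗ
      symSqOperator (fourTermQuartic a' c' e') (fourTermQuadratic b' d') = 0 := by
    refine LinearMap.ext fun p => ?_
    rw [LinearMap.comp_apply, LinearMap.comp_apply, ← symSqOperator_taylor,
      translate (h'.quartic.trans h.quartic.symm), translate (h'.quadratic.trans h.quadratic.symm)]
    exact LinearMap.congr_fun hL _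
  have hL'_one : (L ∘ₗ taylor (ε' - ε)) (X ^ 0) = 1 := by
    rw [pow_zero, LinearMap.comp_apply, taylor_one, C_1, ← pow_zero X, momentFunctional_X_pow,
      fourTermSeq_zero]
  have hL'_rec := (comp_symSqOperator_fourTerm_eq_zero_iff _).1 hL'
  rw [← eq_fourTermSeq_of_rec (T := fun n => (L ∘ₗ taylor (ε' - ε)) (X ^ n)) hL'_one hL'_rec,
    LinearMap.comp_apply, taylor_X_pow, momentFunctional_X_add_C_pow]

theorem eventually_hasSum_fourTermSeq (h : IsFourTermExpansion P R ε a b c d e)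
    (h' : IsFourTermExpansion P R ε' a' b' c' d' e') :
    ∀ᶠ x : ℂ in 𝓝 0, HasSum (fun n => (fourTermSeq a' b' c' d' e' n : ℂ) * x ^ (n + 1))
      (∑' n, (fourTermSeq a b c d e n : ℂ) * (x / (1 - ((ε' - ε : ℝ) : ℂ) * x)) ^ (n + 1)) := by
  set ρ := 1 + 2 * (|a| + |b|) + (|c| + |d|) + 2 * |e|
  have bound (n : ℕ) : ‖(fourTermSeq a b c d e n : ℂ)‖ ≤ ρ ^ n := by
    rw [Complex.norm_real]
    exact abs_fourTermSeq_le a b c d e n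
  have small : ∀ᶠ x : ℂ in 𝓝 0, ‖x‖ * (ρ + ‖((ε' - ε : ℝ) : ℂ)‖) < 1 :=
    ContinuousAt.eventually_lt (by fun_prop) continuousAt_const (by simp)
  filter_upwards [small] with x hx
  refine (hasSum_binomialTransform_mul_pow bound hx).congr_fun fun n => ?_
  rw [fourTermSeq_eq_binomialTransform h h']
  exact congrArg (· * x ^ (n + 1)) (map_binomialTransform Complex.ofRealHom _ _ n)

theorem eventually_hasSum_fourTermSeq_div (h : IsFourTermExpansion P R ε a b c d e)
    (h' : IsFourTermExpansion P R ε' a' b' c' d' e') (κ : ℂ) :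
    ∀ᶠ w : ℂ in 𝓝 0,
      HasSum (fun n => (fourTermSeq a' b' c' d' e' n : ℂ) *
          (w / (1 + (ε' : ℂ) * w + κ * w ^ 2)) ^ (n + 1))
        (∑' n, (fourTermSeq a b c d e n : ℂ) * (w / (1 + (ε : ℂ) * w + κ * w ^ 2)) ^ (n + 1)) := by
  have tendsto_zero : Tendsto (fun w : ℂ => w / (1 + (ε' : ℂ) * w + κ * w ^ 2)) (𝓝 0) (𝓝 0) := by
    have : ContinuousAt (fun w : ℂ => w / (1 + (ε' : ℂ) * w + κ * w ^ 2)) 0 :=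
      ContinuousAt.div (by fun_prop) (by fun_prop) (by simp)
    simpa using this.tendsto
  have denom_ne_zero : ∀ᶠ w : ℂ in 𝓝 0, 1 + (ε' : ℂ) * w + κ * w ^ 2 ≠ 0 :=
    ContinuousAt.eventually_ne (by fun_prop) (by simp)
  filter_upwards [tendsto_zero.eventually (eventually_hasSum_fourTermSeq h h'), denom_ne_zero]
    with w hsum hw
  have one_sub : 1 - ((ε' - ε : ℝ) : ℂ) * (w / (1 + (ε' : ℂ) * w + κ * w ^ 2)) =
      (1 + (ε : ℂ) * w + κ * w ^ 2) / (1 + (ε' : ℂ) * w + κ * w ^ 2) := by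
    rw [eq_div_iff hw, sub_mul, mul_assoc, div_mul_cancel₀ _ hw]
    push_cast
    ring
  simpa only [one_sub, div_div_div_cancel_right₀ hw] using hsum

end FourTermSeq

section LevelFourteen

/-- The common quartic of the four sequences of level `14`; its roots are the `-ε`. -/
noncomputable def quarticFourteen : ℝ[X] := (X + 5) * (X + 9) * (X ^ 2 - 32)

/-- The common quadratic polynomial of the four sequences of level `14`. -/
noncomputable def quadraticFourteen : ℝ[X] := X ^ 2 + 8 * X + 11

theorem isFourTermExpansion_T14A :
    IsFourTermExpansion quarticFourteen quadraticFourteen 5 3 1 47 4 14 where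
  quartic := by
    refine Polynomial.funext fun x => ?_
    simp only [quarticFourteen, fourTermQuartic, taylor_eval, eval_add, eval_sub, eval_mul,
      eval_pow, eval_X, eval_C, eval_ofNat]
    ring
  quadratic := by
    refine Polynomial.funext fun x => ?_
    simp only [quadraticFourteen, fourTermQuadratic, taylor_eval, eval_add, eval_sub, eval_mul,
      eval_pow, eval_X, eval_C, eval_ofNat]
    ring

theorem isFourTermExpansion_T14B :
    IsFourTermExpansion quarticFourteen quadraticFourteen 9 11 5 (-121) (-20) 98 where
  quartic := by
    refine Polynomial.funext fun x => ?_
    simp only [quarticFourteen, fourTermQuartic, taylor_eval, eval_add, eval_sub, eval_mul,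
      eval_pow, eval_X, eval_C, eval_ofNat]
    ring
  quadratic := by
    refine Polynomial.funext fun x => ?_
    simp only [quadraticFourteen, fourTermQuadratic, taylor_eval, eval_add, eval_sub, eval_mul,
      eval_pow, eval_X, eval_C, eval_ofNat]
    ring

theorem isFourTermExpansion_T14C {s : ℝ} (hs : s ^ 2 = 2) :
    IsFourTermExpansion quarticFourteen quadraticFourteen (4 * s) (8 * s - 7) (4 * s - 4)
      (168 * s - 205) (32 * s - 43) (28 * (11 * s - 16)) where
  quartic := by
    refine Polynomial.funext fun x => ?_
    simp only [quarticFourteen, fourTermQuartic, taylor_eval, eval_add, eval_sub, eval_mul,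
      eval_pow, eval_X, eval_C, eval_ofNat]
    linear_combination
      (-768 * s ^ 2 - (512 * x + 1792) * s - 96 * x ^ 2 - 672 * x - 720) * hs
  quadratic := by
    refine Polynomial.funext fun x => ?_
    simp only [quadraticFourteen, fourTermQuadratic, taylor_eval, eval_add, eval_sub, eval_mul,
      eval_pow, eval_X, eval_C, eval_ofNat]
    linear_combination -16 * hs

end LevelFourteen

theorem mainTheorem6 :
    ∀ᶠ w : ℂ in nhds 0, ∃ S : ℂ,
      HasSum (fun n : ℕ => (T14A n : ℂ) * (w / (1 + 5 * w + 8 * w ^ 2)) ^ (n + 1)) S ∧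
      HasSum (fun n : ℕ => (T14B n : ℂ) * (w / (1 + 9 * w + 8 * w ^ 2)) ^ (n + 1)) S ∧
      HasSum (fun n : ℕ =>
        (T14C n : ℂ) * (w / (1 + ((√32 : ℝ) : ℂ) * w + 8 * w ^ 2)) ^ (n + 1)) S ∧
      HasSum (fun n : ℕ =>
        (T14Cbar n : ℂ) * (w / (1 - ((√32 : ℝ) : ℂ) * w + 8 * w ^ 2)) ^ (n + 1)) S := by
  have sqrt_32 : √(32 : ℝ) = 4 * √2 := by
    rw [show (32 : ℝ) = 4 ^ 2 * 2 by norm_num, Real.sqrt_mul (by norm_num),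
      Real.sqrt_sq (by norm_num)]
  have sqrt_two_sq : √(2 : ℝ) ^ 2 = 2 := Real.sq_sqrt (by norm_num)
  have expansionA := isFourTermExpansion_T14A
  have expansionC := isFourTermExpansion_T14C sqrt_two_sq
  have expansionCbar := isFourTermExpansion_T14C ((neg_sq √2).trans sqrt_two_sq)
  filter_upwards [eventually_hasSum_fourTermSeq_div expansionA expansionA 8,
    eventually_hasSum_fourTermSeq_div expansionA isFourTermExpansion_T14B 8,
    eventually_hasSum_fourTermSeq_div expansionA expansionC 8,
    eventually_hasSum_fourTermSeq_div expansionA expansionCbar 8] with w hA hB hC hCbar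
  refine ⟨_, by simpa [T14A] using hA, by simpa [T14B] using hB, ?_, ?_⟩
  · simpa [T14C, sqrt_32] using hC
  · convert! hCbar using 4 with n
    · rw [T14Cbar]
      ring_nf
    · rw [sqrt_32]
      push_cast
      ring
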